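/- Consider a loss system with $K\ge 1$ customer classes and two layers of servers: layer 1 has $m_k\ge 0$ servers dedicated to class $k$, and layer 2 has $n\ge 0$ servers that can serve all classes. Its state space is $$S=\Big\{x\in\mathbb Z_+^K\times\mathbb Z_+^K:\ x_{1,k}\le m_k\ \text{for all } k,\ \ \sum_{k=1}^K x_{2,k}\le n\Big\},$$ where $x_{i,k}$ is the number of class-$k$ customers served at layer $i$. Given arrival rates $\lambda_k\ge 0$ and service rates $\mu_k\ge 0$, the process $X=(X_{i,k})$ is a continuous-time Markov process on $S$ with paths in the space $D(\mathbb R_+,S)$ of right-continuous functions with left-hand limits, with transitions $x\mapsto x+e_{i,k}$ at rate $\lambda_k 1(x\in A_{i,k})$ and $x\mapsto x-e_{i,k}$ at rate $\mu_k x_{i,k}$, where $e_{i,k}$ are the unit vectors and $$A_{1,k}=\{x\in S: x_{1,k}<m_k\},\qquad A_{2,k}=\Big\{x\in S: x_{1,k}=m_k,\ \sum_{l=1}^K x_{2,l}<n\Big\}.$$ For $x,y\in S$ write $x\preceq y$ if $x_{1,k}\le y_{1,k}$ for all $k$ and $|x|\le|y|$, where $|x|=\sum_{i,k}x_{i,k}$;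 for $f,g\in D(\mathbb R_+,S)$ write $f\preceq g$ if $f(t)\preceq g(t)$ for all $t\ge 0$. For processes $U,V$ with paths in $D(\mathbb R_+,S)$ write $U\preceq_{\mathrm{st}}V$ if $\operatorname{E}\varphi(U)\le\operatorname{E}\varphi(V)$ for all bounded measurable $\varphi:D(\mathbb R_+,S)\to\mathbb R$ that are increasing with respect to $\preceq$. Let $X^-$ and $X^+$ be processes of the same type as $X$, with the same $m$, $n$ and $\lambda$, but with all service rates set to $\mu_{\max}=\max_k\mu_k$ and to $\mu_{\min}=\min_k\mu_k$, respectively. Let $X^-,X,X^+$ be defined on a common probability space, with arbitrary joint distribution, and assume that their (possibly random) initial states satisfy $X^-(0)\preceq X(0)\preceq X^+(0)$ almost surely. Then $$X^-\preceq_{\mathrm{st}}X\preceq_{\mathrm{st}}X^+ .$$ -/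

import Mathlib

open MeasureTheory Set Filter Topology
open scoped NNReal

noncomputable section

namespace TwoLayerLoss

/-! ### Path space and stochastic order -/

/-- Right-continuous functions on `[0, ∞)` with left-hand limits. -/
def IsCadlag {E : Type*} [TopologicalSpace E] (f : ℝ≥0 → E) : Prop :=
  (∀ t, ContinuousWithinAt f (Ici t) t) ∧
    ∀ t, 0 < t → ∃ l, Tendsto f (𝓝[<] t) (𝓝 l)

/-- The path space `D(ℝ₊, E)`. Being a subtype of a product, it carries the σ-algebra generated by
the evaluation maps `f ↦ f t`, which is the usual one on this space. -/
abbrev PathSpace (E : Type*) [TopologicalSpace E] : Type _ :=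
  {f : ℝ≥0 → E // IsCadlag f}

/-- The extension of a relation on `E` to paths: `f` and `g` are related if `f t` and `g t` are
for every `t`. -/
def PathRel {E : Type*} [TopologicalSpace E] (r : E → E → Prop) (f g : PathSpace E) : Prop :=
  ∀ t, r (f.1 t) (g.1 t)

/-- Stochastic order of two random elements `U`, `V` of `E` with respect to a preorder `r` on `E`:
`E φ(U) ≤ E φ(V)` for every bounded measurable `r`-increasing `φ : E → ℝ`. -/
def StochLE {E Ω Ω' : Type*} [MeasurableSpace E] [MeasurableSpace Ω] [MeasurableSpace Ω']
    (r : E → E → Prop) (P : Measure Ω) (U : Ω → E) (P' : Measure Ω') (V : Ω' → E) : Prop :=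
  ∀ φ : E → ℝ, Measurable φ → (∃ C, ∀ a, |φ a| ≤ C) → (∀ a b, r a b → φ a ≤ φ b) →
    ∫ ω, φ (U ω) ∂P ≤ ∫ ω, φ (V ω) ∂P'

/-! ### Continuous-time Markov processes on a finite set -/

/-- `X` is a continuous-time Markov process on the finite set `S` with paths in `D(ℝ₊, S)` and
generator `Q`, with an arbitrary initial distribution: given the values at times
`t 0 < ⋯ < t r`, the value at a later time `s` has the distribution given by the row
`x r` of the transition matrix `exp ((s - t r) Q)`. -/
structure IsMarkovProcess {S Ω : Type*} [Fintype S] [DecidableEq S] [TopologicalSpace S]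
    [MeasurableSpace S] [MeasurableSpace Ω] (Q : Matrix S S ℝ) (P : Measure Ω)
    (X : Ω → PathSpace S) : Prop where
  measurable : Measurable X
  markov : ∀ (r : ℕ) (t : Fin (r + 1) → ℝ≥0) (s : ℝ≥0) (x : Fin (r + 1) → S) (y : S),
    StrictMono t → t (Fin.last r) < s →
      P.real {ω | (∀ j, (X ω).1 (t j) = x j) ∧ (X ω).1 s = y} =
        P.real {ω | ∀ j, (X ω).1 (t j) = x j} *
          NormedSpace.exp (((s : ℝ) - (t (Fin.last r) : ℝ)) • Q) (x (Fin.last r)) y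

/-! ### The two-layer loss system

A state is a function `x` where `x 0 k` and `x 1 k` are the numbers of class-`k` customers served
at layer 1 and at layer 2, respectively. -/

variable {K : ℕ}

/-- The state space `S` with `m k` servers for class `k` at layer 1, and `n` servers at layer 2. -/
def stateSpace (m : Fin K → ℕ) (n : ℕ) : Set (Fin 2 → Fin K → ℕ) :=
  {x | (∀ k, x 0 k ≤ m k) ∧ ∑ k, x 1 k ≤ n}

abbrev State (m : Fin K → ℕ) (n : ℕ) : Type := stateSpace m n

theorem stateSpace_finite (m : Fin K → ℕ) (n : ℕ) : (stateSpace m n).Finite := by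
  refine (Set.finite_Iic (fun (i : Fin 2) (k : Fin K) => if i = 0 then m k else n)).subset ?_
  intro x hx i k
  fin_cases i
  · simpa using hx.1 k
  · simpa using (Finset.single_le_sum (f := fun l => x 1 l) (fun _ _ => Nat.zero_le _)
      (Finset.mem_univ k)).trans hx.2

instance (m : Fin K → ℕ) (n : ℕ) : Fintype (State m n) := (stateSpace_finite m n).fintype

/-- The total number of customers `|x|`. -/
def total (x : Fin 2 → Fin K → ℕ) : ℕ := ∑ i, ∑ k, x i k

/-- The preorder on states: `x 0 k ≤ y 0 k` for all `k`, and `|x| ≤ |y|`. -/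
def Preceq {m : Fin K → ℕ} {n : ℕ} (x y : State m n) : Prop :=
  (∀ k, x.1 0 k ≤ y.1 0 k) ∧ total x.1 ≤ total y.1

/-- The unit vector in the coordinate direction `(i, k)`. -/
def unitVec (i : Fin 2) (k : Fin K) : Fin 2 → Fin K → ℕ := Pi.single i (Pi.single k 1)

/-- The rate of jumps from `x` to `y`, for the transitions `x ↦ x + unitVec i k` at rate `up i k x`
and `x ↦ x - unitVec i k` at rate `down i k x`. -/
def jumpRate {m : Fin K → ℕ} {n : ℕ} (up down : Fin 2 → Fin K → State m n → ℝ)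
    (x y : State m n) : ℝ :=
  ∑ i, ∑ k, ((if y.1 = x.1 + unitVec i k then up i k x else 0) +
    (if x.1 = y.1 + unitVec i k then down i k x else 0))

/-- The generator with the given upward and downward transition rates. -/
def generator {m : Fin K → ℕ} {n : ℕ} (up down : Fin 2 → Fin K → State m n → ℝ) :
    Matrix (State m n) (State m n) ℝ :=
  fun x y => if x = y then -∑ z ∈ Finset.univ.erase x, jumpRate up down x z
    else jumpRate up down x y

/-- The states in which an arriving class-`k` customer is assigned to the given layer. -/
def acceptSet (m : Fin K → ℕ) (n : ℕ) : Fin 2 → Fin K → Set (State m n)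
  | 0, k => {x | x.1 0 k < m k}
  | 1, k => {x | x.1 0 k = m k ∧ ∑ l, x.1 1 l < n}

/-- Upward rates under overflow routing with arrival rates `lam`. -/
def arrivalRate (m : Fin K → ℕ) (n : ℕ) (lam : Fin K → ℝ) (i : Fin 2) (k : Fin K)
    (x : State m n) : ℝ :=
  (acceptSet m n i k).indicator (fun _ => lam k) x

/-- Downward rates with service rates `mu`. -/
def departureRate (m : Fin K → ℕ) (n : ℕ) (mu : Fin K → ℝ) (i : Fin 2) (k : Fin K)
    (x : State m n) : ℝ :=
  mu k * (x.1 i k : ℝ)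

/-- `X` is the process of customer numbers in the two-layer loss system with overflow routing,
arrival rates `lam` and service rates `mu`. -/
def IsLossSystem {Ω : Type*} [MeasurableSpace Ω] (m : Fin K → ℕ) (n : ℕ) (lam mu : Fin K → ℝ)
    (P : Measure Ω) (X : Ω → PathSpace (State m n)) : Prop :=
  IsMarkovProcess (generator (arrivalRate m n lam) (departureRate m n mu)) P X

end TwoLayerLoss

end

/-!
The proof couples the two processes so that the path of the smaller one stays below that of the
larger one.

*Coupling of the rates.* Let `x ⪯ y`, and suppose that every service rate of the process started
from `x` is at least some `c`, which is at least every service rate of the process started from `y`.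
The two processes receive the same arrivals (`Preceq.arriveState`), and the class-`k` layer-1
customers of `x` are paired with class-`k` layer-1 customers of `y`, the departure of the latter
always being accompanied by that of the former. If `|x| < |y|`, the other departures may occur
independently. If `|x| = |y|`, the unpaired customers of `y` are as many as the layer-2 customers of
`x`, so that their total departure rate is not larger, and each of their departures can be made
simultaneous with a layer-2 departure of `x` (`CoupledRows.sum_jump`). This is
`coupledRows_generator`; both comparisons are instances of it, with `c` the maximal and the minimal
service rate.

*From rates to paths.* The coupled rates form a generator on the set of ordered pairs of states,
which projects to the two given generators. Its exponential is nonnegative and projects to the two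
transition functions, so it extends the given coupling of the initial states to ordered couplings at
finitely many times (`exists_coupling_weights`). No coupled path needs to be constructed in
continuous time: as the space of probability measures on a compact space is compact, these
couplings have a limit which is an ordered coupling of the restrictions of the two processes to the
rational times (`exists_coupling_of_finite`). A bounded measurable functional of paths is a
measurable functional of the values at rational times (`measurable_comap_restrictRat`), and the
functions on the rational times which are restrictions of càdlàg paths form a measurable set
(`measurableSet_isRegular`, `isRegular_restrictRat`, `IsRegular.exists_path`). Hence the coupling
lives on restrictions of càdlàg paths, which are ordered at all times by right-continuity
(`pathRel_of_restrictRat`).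
-/

noncomputable section

namespace TwoLayerLoss

/-! ### Exponentials of generators -/

section MatrixExponential

variable {S Z : Type*} [Fintype S] [DecidableEq S] [Fintype Z] [DecidableEq Z]

theorem hasSum_matrix_exp (A : Matrix S S ℝ) :
    HasSum (fun n : ℕ => ((n.factorial : ℝ)⁻¹) • A ^ n) (NormedSpace.exp A) := by
  open scoped Matrix.Norms.Operator in
  exact NormedSpace.exp_series_hasSum_exp' (𝕂 := ℝ) A

theorem exp_mul_eq_mul_exp {A : Matrix Z Z ℝ} {J : Matrix Z S ℝ} {B : Matrix S S ℝ}
    (h : A * J = J * B) : NormedSpace.exp A * J = J * NormedSpace.exp B := by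
  have hpow : ∀ n : ℕ, A ^ n * J = J * B ^ n := by
    intro n
    induction n with
    | zero => simp
    | succ n ih => rw [pow_succ, Matrix.mul_assoc, h, ← Matrix.mul_assoc, ih, Matrix.mul_assoc,
        ← pow_succ]
  have h1 := (hasSum_matrix_exp A).map (Matrix.addMonoidHomMulRight J)
    (continuous_id.matrix_mul continuous_const)
  have h2 := (hasSum_matrix_exp B).map (Matrix.addMonoidHomMulLeft J)
    (continuous_const.matrix_mul continuous_id)
  refine h1.unique ?_
  convert! h2 using 1
  funext n
  simp [Matrix.addMonoidHomMulRight, Matrix.addMonoidHomMulLeft, hpow]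

theorem exp_nonneg_of_nonneg {A : Matrix S S ℝ} (h : ∀ x y, 0 ≤ A x y) (x y : S) :
    0 ≤ NormedSpace.exp A x y := by
  have hpow : ∀ (n : ℕ) x y, 0 ≤ (A ^ n) x y := by
    intro n
    induction n with
    | zero => intro x y; rw [pow_zero, Matrix.one_apply]; positivity
    | succ n ih =>
      intro x y
      rw [pow_succ, Matrix.mul_apply]
      exact Finset.sum_nonneg fun z _ => mul_nonneg (ih x z) (h z y)
  have hs := Pi.hasSum.1 (Pi.hasSum.1 (hasSum_matrix_exp A) x) y
  exact hs.nonneg fun n => mul_nonneg (by positivity) (hpow n x y)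

/-- After adding a multiple `c` of the identity, all entries are nonnegative; this multiplies the
exponential by the positive factor `exp c`. -/
theorem exp_nonneg_of_offDiag_nonneg {A : Matrix S S ℝ} (h : ∀ x y, x ≠ y → 0 ≤ A x y)
    (x y : S) : 0 ≤ NormedSpace.exp A x y := by
  -- This is large enough to make every diagonal entry of `A + c • 1` nonnegative.
  set c : ℝ := ∑ z, |A z z| with hc
  have hB : ∀ x y, 0 ≤ (A + c • (1 : Matrix S S ℝ)) x y := by
    intro x y
    by_cases hxy : x = y
    · subst hxy
      have : |A x x| ≤ c := Finset.single_le_sum (f := fun z => |A z z|)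
        (fun _ _ => abs_nonneg _) (Finset.mem_univ x)
      have := neg_abs_le (A x x)
      simp
      linarith
    · simpa [Matrix.one_apply, hxy] using h x y hxy
  have hcomm : Commute (A + c • (1 : Matrix S S ℝ)) ((-c) • (1 : Matrix S S ℝ)) :=
    (Commute.one_right _).smul_right _
  have hA : A = (A + c • (1 : Matrix S S ℝ)) + (-c) • (1 : Matrix S S ℝ) := by
    simp
  have hd : (-c) • (1 : Matrix S S ℝ) = Matrix.diagonal (fun _ => -c) := by
    rw [Matrix.smul_one_eq_diagonal]
  rw [hA, Matrix.exp_add_of_commute _ _ hcomm, hd, Matrix.exp_diagonal, Matrix.mul_diagonal]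
  refine mul_nonneg (exp_nonneg_of_nonneg hB x y) ?_
  rw [Pi.coe_exp, ← Real.exp_eq_exp_ℝ]
  exact (Real.exp_pos _).le

end MatrixExponential

/-! ### Couplings at finitely many times -/

section FiniteDimensional

variable {S Z : Type*} [Fintype S] [DecidableEq S] [Fintype Z] [DecidableEq Z]

/-- The generator `Q` on `Z` projects to the generator `Q'` on `S` along `p : Z → S`. -/
def ProjectsTo (p : Z → S) (Q : Matrix Z Z ℝ) (Q' : Matrix S S ℝ) : Prop :=
  ∀ z a, ∑ c, (if p c = a then Q z c else 0) = Q' (p z) a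

theorem ProjectsTo.exp_smul {p : Z → S} {Q : Matrix Z Z ℝ} {Q' : Matrix S S ℝ}
    (h : ProjectsTo p Q Q') (u : ℝ) :
    ProjectsTo p (NormedSpace.exp (u • Q)) (NormedSpace.exp (u • Q')) := by
  set J : Matrix Z S ℝ := Matrix.of fun z a => if p z = a then 1 else 0 with hJ
  have hl : ∀ (A : Matrix Z Z ℝ) z a, (A * J) z a = ∑ c, (if p c = a then A z c else 0) := by
    intro A z a
    simp [hJ, Matrix.mul_apply]
  have hr : ∀ (B : Matrix S S ℝ) z a, (J * B) z a = B (p z) a := by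
    intro B z a
    simp [hJ, Matrix.mul_apply]
  have hQ : Q * J = J * Q' := by
    ext z a
    rw [hl, hr, h z a]
  have hexp := exp_mul_eq_mul_exp (A := u • Q) (B := u • Q') (J := J)
    (by rw [Matrix.smul_mul, hQ, Matrix.mul_smul])
  intro z a
  rw [← hl, hexp, hr]

variable [TopologicalSpace S] [MeasurableSpace S] {Ω : Type*} [MeasurableSpace Ω]

/-- `w` is a weight function on the `Z`-valued sequences of length `r + 1` whose image under `p`
is the distribution of `X` at the times `t 0, …, t r`. -/
def HasMarginal {r : ℕ} (w : (Fin (r + 1) → Z) → ℝ) (p : Z → S) (P : Measure Ω)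
    (X : Ω → PathSpace S) (t : Fin (r + 1) → ℝ≥0) : Prop :=
  ∀ a : Fin (r + 1) → S, ∑ z, (if ∀ j, p (z j) = a j then w z else 0) =
    P.real {ω | ∀ j, (X ω).1 (t j) = a j}

/-- A coupling at the times `t 0, …, t r` is continued to the next time by a transition of the chain
with generator `Q`. -/
theorem HasMarginal.snoc {r : ℕ} {w : (Fin (r + 1) → Z) → ℝ} {p : Z → S} {P : Measure Ω}
    {X : Ω → PathSpace S} {t : Fin (r + 2) → ℝ≥0} (ht : StrictMono t) {Q : Matrix Z Z ℝ}
    {Q' : Matrix S S ℝ} (hw : HasMarginal w p P X (Fin.init t)) (hX : IsMarkovProcess Q' P X)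
    (hQ : ProjectsTo p Q Q') :
    HasMarginal (fun z : Fin (r + 2) → Z => w (Fin.init z) *
      NormedSpace.exp (((t (Fin.last _) : ℝ) - (t (Fin.last r).castSucc : ℝ)) • Q)
        (z (Fin.last r).castSucc) (z (Fin.last _))) p P X t := by
  intro a
  have hset : {ω | ∀ j, (X ω).1 (t j) = a j} = {ω | (∀ j, (X ω).1 (Fin.init t j) = Fin.init a j) ∧
      (X ω).1 (t (Fin.last _)) = a (Fin.last _)} := by
    ext ω
    simp only [mem_ofPred_eq, Fin.forall_fin_succ', Fin.init]
  have hE := hQ.exp_smul ((t (Fin.last _) : ℝ) - (t (Fin.last r).castSucc : ℝ))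
  rw [hset, hX.markov r (Fin.init t) (t (Fin.last _)) (Fin.init a) (a (Fin.last _))
    (fun i j hij => ht (by simpa using hij)) (ht (Fin.castSucc_lt_last _)), ← hw (Fin.init a),
    ← (Fin.snocEquiv fun _ => Z).sum_comp, Fintype.sum_prod_type_right, Finset.sum_mul]
  refine Finset.sum_congr rfl fun z _ => ?_
  have hlast := hE (z (Fin.last r)) (a (Fin.last _))
  simp only [Fin.snocEquiv, Equiv.coe_fn_mk, Fin.forall_fin_succ', Fin.snoc_castSucc,
    Fin.snoc_last, Fin.init_snoc, Fin.init] at hlast ⊢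
  by_cases hz : ∀ j, p (z j) = a j.castSucc
  · simp only [hz, implies_true, true_and, if_true, ← mul_ite_zero, ← Finset.mul_sum] at hlast ⊢
    rw [hlast]
  · rw [Fin.forall_fin_succ'] at hz
    simp only [hz, false_and, if_false, zero_mul, Finset.sum_const_zero]

variable {Q : Matrix Z Z ℝ} {Q₁ Q₂ : Matrix S S ℝ} {p₁ p₂ : Z → S} {P : Measure Ω}
  {X Y : Ω → PathSpace S}

/-- If the chain with generator `Q` projects onto those of `X` and `Y`, then a coupling of the
initial values extends to a coupling of the values at finitely many times. -/
theorem exists_coupling_weights (hnn : ∀ z z', z ≠ z' → 0 ≤ Q z z')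
    (hQ₁ : ProjectsTo p₁ Q Q₁) (hQ₂ : ProjectsTo p₂ Q Q₂)
    (hX : IsMarkovProcess Q₁ P X) (hY : IsMarkovProcess Q₂ P Y)
    (h0 : ∃ w : Z → ℝ, (∀ z, 0 ≤ w z) ∧
      (∀ a, ∑ z, (if p₁ z = a then w z else 0) = P.real {ω | (X ω).1 0 = a}) ∧
      ∀ a, ∑ z, (if p₂ z = a then w z else 0) = P.real {ω | (Y ω).1 0 = a})
    (r : ℕ) (t : Fin (r + 1) → ℝ≥0) (ht : StrictMono t) (ht0 : t 0 = 0) :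
    ∃ w : (Fin (r + 1) → Z) → ℝ, (∀ z, 0 ≤ w z) ∧ HasMarginal w p₁ P X t ∧
      HasMarginal w p₂ P Y t := by
  induction r with
  | zero =>
    obtain ⟨w, hw, hw₁, hw₂⟩ := h0
    refine ⟨fun z => w (z 0), fun z => hw _, fun a => ?_, fun a => ?_⟩
    · rw [← (Equiv.funUnique (Fin 1) Z).symm.sum_comp]
      simpa [ht0, Fin.forall_fin_one] using hw₁ (a 0)
    · rw [← (Equiv.funUnique (Fin 1) Z).symm.sum_comp]
      simpa [ht0, Fin.forall_fin_one] using hw₂ (a 0)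
  | succ r ih =>
    obtain ⟨w, hw, hw₁, hw₂⟩ := ih (Fin.init t) (fun i j hij => ht (by simpa using hij)) ht0
    refine ⟨_, fun z => mul_nonneg (hw _) (exp_nonneg_of_offDiag_nonneg ?_ _ _),
      hw₁.snoc ht hX hQ₁, hw₂.snoc ht hY hQ₂⟩
    intro x y hxy
    refine mul_nonneg (sub_nonneg.2 ?_) (hnn x y hxy)
    exact_mod_cast (ht (Fin.castSucc_lt_last _)).le

end FiniteDimensional

/-! ### Gluing finite-dimensional couplings by compactness -/

section Gluing

variable {S Z D : Type*}

/-- Finite measures on a product are determined by their finite-dimensional marginals. -/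
theorem ext_of_restrict [MeasurableSpace S] {ν ν' : Measure (D → S)} [IsFiniteMeasure ν']
    (h : ∀ F : Finset D, ν.map F.restrict = ν'.map F.restrict) : ν = ν' :=
  IsProjectiveLimit.unique (P := fun F => ν'.map F.restrict) h (fun _ => rfl)

variable [Finite S] [MeasurableSpace S] [DiscreteMeasurableSpace S]
  [Finite Z] [MeasurableSpace Z] [TopologicalSpace Z] [DiscreteTopology Z] [BorelSpace Z]
  [Countable D]

/-- Along weakly convergent measures, probabilities of events depending on finitely many coordinates
converge, since such events are clopen. -/
theorem tendsto_map_restrict {ι : Type*} {L : Filter ι} {π : ProbabilityMeasure (D → Z)}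
    {πs : ι → ProbabilityMeasure (D → Z)} (h : Tendsto πs L (𝓝 π)) (p : Z → S) (F : Finset D)
    (A : Set (F → S)) :
    Tendsto (fun i => (πs i : Measure (D → Z)).map (fun z (d : F) => p (z d)) A) L
      (𝓝 ((π : Measure (D → Z)).map (fun z (d : F) => p (z d)) A)) := by
  have hp : Measurable p := .of_discrete
  have hA : MeasurableSet A := A.toFinite.measurableSet
  have hm : Measurable fun (z : D → Z) (d : F) => p (z d) := by fun_prop
  have hclopen : IsClopen ((fun (z : D → Z) (d : F) => p (z d)) ⁻¹' A) :=
    (isClopen_discrete ((fun (z : F → Z) d => p (z d)) ⁻¹' A)).preimage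
      (f := fun (z : D → Z) (d : F) => z d) (by fun_prop)
  simp only [Measure.map_apply hm hA]
  exact ProbabilityMeasure.tendsto_measure_of_null_frontier_of_tendsto' h
    (by simp [hclopen.frontier_eq])

/-- Compactness of the space of probability measures on `D → Z` glues couplings of the
finite-dimensional marginals of `ν₁` and `ν₂` to a coupling of `ν₁` and `ν₂`. -/
theorem exists_coupling_of_finite (ν₁ ν₂ : Measure (D → S)) [IsFiniteMeasure ν₁]
    [IsFiniteMeasure ν₂] (p₁ p₂ : Z → S)
    (h : ∀ F : Finset D, ∃ F', F ⊆ F' ∧ ∃ π : ProbabilityMeasure (D → Z),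
      (π : Measure (D → Z)).map (fun z (d : F') => p₁ (z d)) = ν₁.map F'.restrict ∧
      (π : Measure (D → Z)).map (fun z (d : F') => p₂ (z d)) = ν₂.map F'.restrict) :
    ∃ π : ProbabilityMeasure (D → Z), (π : Measure (D → Z)).map (fun z d => p₁ (z d)) = ν₁ ∧
      (π : Measure (D → Z)).map (fun z d => p₂ (z d)) = ν₂ := by
  classical
  choose F' hF' πs h₁ h₂ using h
  -- The ultrafilter contains all sets of large finite subsets of `D`, so that along it every
  -- finite-dimensional marginal is eventually the prescribed one.
  set U : Ultrafilter (Finset D) := Ultrafilter.of atTop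
  have hU : (U : Filter (Finset D)) ≤ atTop := Ultrafilter.of_le _
  obtain ⟨π, -, hπ⟩ := isCompact_univ.ultrafilter_le_nhds (U.map πs) (by simp)
  have hπ' : Tendsto πs U (𝓝 π) := hπ
  have key : ∀ (ν : Measure (D → S)) [IsFiniteMeasure ν] (p : Z → S),
      (∀ F, (πs F : Measure (D → Z)).map (fun z (d : F' F) => p (z d)) =
        ν.map (F' F).restrict) → (π : Measure (D → Z)).map (fun z d => p (z d)) = ν := by
    intro ν _ p hp
    have hm : Measurable p := .of_discrete
    refine ext_of_restrict fun F => ?_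
    rw [Measure.map_map (Finset.measurable_restrict F) (by fun_prop)]
    ext A -
    refine tendsto_nhds_unique (tendsto_map_restrict hπ' p F A) ?_
    refine tendsto_const_nhds.congr' ?_
    filter_upwards [hU (eventually_ge_atTop F)] with G hG
    have hFG : F ⊆ F' G := hG.trans (hF' G)
    let ρ : (F' G → S) → F → S := fun x d => x ⟨d, hFG d.2⟩
    have hρ : Measurable ρ := by fun_prop
    have h1 : ν.map F.restrict = (ν.map (F' G).restrict).map ρ :=
      (Measure.map_map (f := fun (x : D → S) (d : F' G) => x d) hρ (by fun_prop)).symm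
    rw [h1, ← hp G, Measure.map_map hρ (by fun_prop)]
    rfl
  exact ⟨π, key ν₁ p₁ h₁, key ν₂ p₂ h₂⟩

end Gluing

/-! ### Couplings at rational times -/

section RationalTimes

variable {S Z : Type*} [TopologicalSpace S]

/-- The restriction of a path to the rational times. -/
def restrictRat (f : PathSpace S) (d : ℚ≥0) : S := f.1 d

variable [MeasurableSpace S]

theorem measurable_restrictRat : Measurable (restrictRat (S := S)) :=
  measurable_pi_lambda _ fun d => (measurable_pi_apply (d : ℝ≥0)).comp measurable_subtype_coe

variable [Fintype S] [DecidableEq S] [DiscreteMeasurableSpace S]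
  [Fintype Z] [MeasurableSpace Z] [DiscreteMeasurableSpace Z]
  {Ω : Type*} [MeasurableSpace Ω] {P : Measure Ω} [IsProbabilityMeasure P]

/-- Weights on sequences indexed by `Fin (r + 1) ≃ F`, transported by `x` to functions on `ℚ≥0`, form
a measure with the right marginal on `F`. -/
theorem HasMarginal.map_eq {r : ℕ} {w : (Fin (r + 1) → Z) → ℝ} (hw : ∀ z, 0 ≤ w z) {p : Z → S}
    {X : Ω → PathSpace S} (hX : Measurable X) {F : Finset ℚ≥0} (e : Fin (r + 1) ≃ F)
    (h : HasMarginal w p P X fun j => ((e j : ℚ≥0) : ℝ≥0))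
    (x : (Fin (r + 1) → Z) → ℚ≥0 → Z) (hx : ∀ z j, x z (e j) = z j) :
    (∑ z, ENNReal.ofReal (w z) • Measure.dirac (x z)).map (fun z (d : F) => p (z d)) =
      (P.map fun ω => restrictRat (X ω)).map F.restrict := by
  have hp : Measurable p := .of_discrete
  have hm : Measurable fun (z : ℚ≥0 → Z) (d : F) => p (z d) := by fun_prop
  refine Measure.ext_of_singleton fun b => ?_
  have hb : MeasurableSet {b} := measurableSet_singleton b
  have hX' : Measurable fun ω => restrictRat (X ω) := measurable_restrictRat.comp hX
  rw [Measure.map_apply hm hb, Measure.map_apply (Finset.measurable_restrict F) hb,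
    Measure.map_apply hX' (Finset.measurable_restrict F hb)]
  have hΩ : (fun ω => restrictRat (X ω)) ⁻¹' (F.restrict ⁻¹' {b}) =
      {ω | ∀ j, (X ω).1 ((e j : ℚ≥0) : ℝ≥0) = b (e j)} := by
    ext ω
    simp only [mem_preimage, mem_singleton_iff, mem_ofPred_eq, funext_iff]
    exact (e.forall_congr_right (q := fun d : F => restrictRat (X ω) d = b d)).symm
  rw [hΩ, ← ofReal_measureReal (μ := P), ← h fun j => b (e j), ENNReal.ofReal_sum_of_nonneg
    (fun z _ => by split_ifs; exacts [hw z, le_rfl]), Measure.finsetSum_apply]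
  refine Finset.sum_congr rfl fun z _ => ?_
  rw [Measure.smul_apply, Measure.dirac_apply' _ (hm hb), smul_eq_mul]
  have hz : x z ∈ (fun (z : ℚ≥0 → Z) (d : F) => p (z d)) ⁻¹' {b} ↔ ∀ j, p (z j) = b (e j) := by
    simp only [mem_preimage, mem_singleton_iff, funext_iff]
    rw [← e.forall_congr_right]
    simp only [hx]
  by_cases hzb : ∀ j, p (z j) = b (e j)
  · rw [if_pos hzb, indicator_of_mem (hz.2 hzb)]
    simp
  · rw [if_neg hzb, indicator_of_notMem (fun h => hzb (hz.1 h))]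
    simp

variable [DecidableEq Z] {Q : Matrix Z Z ℝ} {Q₁ Q₂ : Matrix S S ℝ} {p₁ p₂ : Z → S}
  {X Y : Ω → PathSpace S}

/-- The weights of `exists_coupling_weights` as a probability measure on functions on all rational
times; only its marginal on `F` matters. -/
theorem exists_coupling_finset (hnn : ∀ z z', z ≠ z' → 0 ≤ Q z z')
    (hQ₁ : ProjectsTo p₁ Q Q₁) (hQ₂ : ProjectsTo p₂ Q Q₂)
    (hX : IsMarkovProcess Q₁ P X) (hY : IsMarkovProcess Q₂ P Y)
    (h0 : ∃ w : Z → ℝ, (∀ z, 0 ≤ w z) ∧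
      (∀ a, ∑ z, (if p₁ z = a then w z else 0) = P.real {ω | (X ω).1 0 = a}) ∧
      ∀ a, ∑ z, (if p₂ z = a then w z else 0) = P.real {ω | (Y ω).1 0 = a})
    (F : Finset ℚ≥0) (hF : 0 ∈ F) :
    ∃ π : ProbabilityMeasure (ℚ≥0 → Z),
      (π : Measure (ℚ≥0 → Z)).map (fun z (d : F) => p₁ (z d)) =
        (P.map fun ω => restrictRat (X ω)).map F.restrict ∧
      (π : Measure (ℚ≥0 → Z)).map (fun z (d : F) => p₂ (z d)) =
        (P.map fun ω => restrictRat (Y ω)).map F.restrict := by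
  obtain ⟨r, hr⟩ : ∃ r, F.card = r + 1 :=
    ⟨F.card - 1, (Nat.sub_add_cancel (Finset.card_pos.2 ⟨0, hF⟩)).symm⟩
  set e : Fin (r + 1) ≃o F := F.orderIsoOfFin hr with he
  have he0 : (e 0 : ℚ≥0) = 0 := by
    refine le_antisymm ?_ zero_le
    have h1 : e 0 ≤ ⟨0, hF⟩ := by
      rw [← e.apply_symm_apply ⟨0, hF⟩]
      exact e.monotone (Fin.zero_le _)
    exact h1
  obtain ⟨w, hw, hw₁, hw₂⟩ := exists_coupling_weights hnn hQ₁ hQ₂ hX hY h0 r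
    (fun j => ((e j : ℚ≥0) : ℝ≥0))
    (fun i j hij => NNRat.cast_strictMono (K := ℝ≥0) (e.strictMono hij)) (by simp [he0])
  -- The value `z 0` at the times outside `F` is arbitrary.
  let x : (Fin (r + 1) → Z) → ℚ≥0 → Z := fun z d =>
    if h : d ∈ F then z (e.symm ⟨d, h⟩) else z 0
  have hx : ∀ z j, x z (e j) = z j := fun z j => by simp [x]
  have h₁ := hw₁.map_eq hw hX.measurable e.toEquiv x hx
  have h₂ := hw₂.map_eq hw hY.measurable e.toEquiv x hx
  refine ⟨⟨_, ⟨?_⟩⟩, h₁, h₂⟩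
  have hp : Measurable p₁ := .of_discrete
  have hm : Measurable fun (z : ℚ≥0 → Z) (d : F) => p₁ (z d) := by fun_prop
  have hX' : Measurable fun ω => restrictRat (X ω) := measurable_restrictRat.comp hX.measurable
  have hu := DFunLike.congr_fun h₁ univ
  rw [Measure.map_apply hm .univ, Measure.map_apply (Finset.measurable_restrict F) .univ,
    preimage_univ, preimage_univ, Measure.map_apply hX' .univ, preimage_univ,
    measure_univ (μ := P)] at hu
  exact hu

end RationalTimes

/-! ### Paths and their values at rational times -/

section Regularization

variable {S : Type*}

theorem exists_nnrat_between {x y : ℝ≥0} (h : x < y) : ∃ d : ℚ≥0, x < d ∧ (d : ℝ≥0) < y := by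
  obtain ⟨q, hq, hxq, hqy⟩ := (NNReal.lt_iff_exists_rat_btwn x y).1 h
  lift q to ℚ≥0 using hq
  have h0 : Real.toNNReal ((q : ℚ) : ℝ) = (q : ℝ≥0) := by
    ext
    rw [Real.coe_toNNReal _ (by positivity)]
    simp only [Rat.cast_nnratCast]
    rfl
  exact ⟨q, h0 ▸ hxq, h0 ▸ hqy⟩

/-- On the rational times in `(a, b)`, the function `f` changes its value at most once. -/
def SingleJumpOn (f : ℚ≥0 → S) (a b : ℝ) : Prop :=
  ∀ d₁ d₂ d₃ : ℚ≥0, a < (d₁ : ℝ≥0) → d₁ < d₂ → d₂ < d₃ → ((d₃ : ℝ≥0) : ℝ) < b → f d₁ = f d₂ ∨ f d₂ = f d₃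

/-- A description by countably many conditions of the functions on `ℚ≥0` that are restrictions of
càdlàg paths: each bounded time interval is covered by finitely many open intervals with at most
one jump each, and there is no jump immediately after a rational time. -/
def IsRegular (f : ℚ≥0 → S) : Prop :=
  (∀ T : ℕ, ∃ C : Finset (ℚ × ℚ), (∀ t : ℝ≥0, t ≤ T → ∃ p ∈ C, (p.1 : ℝ) < t ∧ t < (p.2 : ℝ)) ∧
      ∀ p ∈ C, SingleJumpOn f p.1 p.2) ∧
    ∀ d : ℚ≥0, ∃ e, d < e ∧ ∀ d', d < d' → d' < e → f d' = f d

/-- The quantifiers in `IsRegular` range over countable sets, except for the one over `t`, which does not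
involve `f`. -/
theorem measurableSet_isRegular [Finite S] [MeasurableSpace S] [DiscreteMeasurableSpace S] :
    MeasurableSet {f : ℚ≥0 → S | IsRegular f} := by
  have heq : ∀ d d' : ℚ≥0, Measurable fun f : ℚ≥0 → S => f d = f d' := by
    intro d d'
    have h : Measurable fun f : ℚ≥0 → S => (f d, f d') := by fun_prop
    exact measurableSet_setOfPred.1 (h (toFinite (diagonal S)).measurableSet)
  rw [measurableSet_setOfPred]
  unfold IsRegular SingleJumpOn
  fun_prop

/-- A regular function is constant on the rational times in a right neighbourhood of `t`: a jump in
`(t, b)` is the only one in the interval covering `t`, so there is none between `t` and it. -/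
theorem IsRegular.exists_right {f : ℚ≥0 → S} (hf : IsRegular f) (t : ℝ≥0) :
    ∃ c, ∃ b, t < b ∧ ∀ d : ℚ≥0, t < d → (d : ℝ≥0) < b → f d = c := by
  obtain ⟨T, hT⟩ := exists_nat_ge t
  obtain ⟨C, hC, hjump⟩ := hf.1 T
  obtain ⟨p, hp, hat, htb⟩ := hC t hT
  have hj := hjump p hp
  set b : ℝ≥0 := Real.toNNReal p.2 with hb
  have htb' : t < b := Real.lt_toNNReal_iff_coe_lt.2 htb
  have hbr : ∀ d : ℚ≥0, (d : ℝ≥0) < b → ((d : ℝ≥0) : ℝ) < (p.2 : ℝ) := fun d hd =>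
    Real.lt_toNNReal_iff_coe_lt.1 hd
  have har : ∀ d : ℚ≥0, t < d → (p.1 : ℝ) < (d : ℝ≥0) := fun d hd =>
    hat.trans (NNReal.coe_lt_coe.2 hd)
  by_cases h : ∃ d₁ d₂ : ℚ≥0, t < d₁ ∧ d₁ < d₂ ∧ (d₂ : ℝ≥0) < b ∧ f d₁ ≠ f d₂
  · obtain ⟨d₁, d₂, h1, h12, h2, hne⟩ := h
    refine ⟨f d₁, d₁, h1, fun d hd hd1 => ?_⟩
    exact (hj d d₁ d₂ (har d hd) (by exact_mod_cast hd1) h12 (hbr _ h2)).resolve_right hne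
  · push Not at h
    obtain ⟨d₀, h0, h0b⟩ := exists_nnrat_between htb'
    refine ⟨f d₀, b, htb', fun d hd hdb => ?_⟩
    rcases lt_trichotomy d d₀ with hlt | rfl | hlt
    · exact h d d₀ hd hlt h0b
    · rfl
    · exact (h d₀ d h0 hlt hdb).symm

/-- A regular function is constant on the rational times in a left neighbourhood of `t`. -/
theorem IsRegular.exists_left {f : ℚ≥0 → S} (hf : IsRegular f) {t : ℝ≥0} (ht : 0 < t) :
    ∃ c, ∃ a, a < t ∧ ∀ d : ℚ≥0, a < d → (d : ℝ≥0) < t → f d = c := by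
  obtain ⟨T, hT⟩ := exists_nat_ge t
  obtain ⟨C, hC, hjump⟩ := hf.1 T
  obtain ⟨p, hp, hat, htb⟩ := hC t hT
  have hj := hjump p hp
  set a : ℝ≥0 := Real.toNNReal p.1 with ha
  have hat' : a < t := by
    rw [← NNReal.coe_lt_coe, ha, Real.coe_toNNReal']
    exact max_lt hat ht
  have har : ∀ d : ℚ≥0, a < d → (p.1 : ℝ) < (d : ℝ≥0) := fun d hd =>
    (Real.le_coe_toNNReal (p.1 : ℝ)).trans_lt (NNReal.coe_lt_coe.2 hd)
  have hbr : ∀ d : ℚ≥0, (d : ℝ≥0) < t → ((d : ℝ≥0) : ℝ) < (p.2 : ℝ) := fun d hd =>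
    (NNReal.coe_lt_coe.2 hd).trans htb
  by_cases h : ∃ d₁ d₂ : ℚ≥0, a < d₁ ∧ d₁ < d₂ ∧ (d₂ : ℝ≥0) < t ∧ f d₁ ≠ f d₂
  · obtain ⟨d₁, d₂, h1, h12, h2, hne⟩ := h
    refine ⟨f d₂, d₂, h2, fun d hd hdt => ?_⟩
    exact ((hj d₁ d₂ d (har _ h1) h12 (by exact_mod_cast hd) (hbr _ hdt)).resolve_left hne).symm
  · push Not at h
    obtain ⟨d₀, h0, h0b⟩ := exists_nnrat_between hat'
    refine ⟨f d₀, a, hat', fun d hd hdb => ?_⟩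
    rcases lt_trichotomy d d₀ with hlt | rfl | hlt
    · exact h d d₀ hd hlt h0b
    · rfl
    · exact (h d₀ d h0 hlt hdb).symm

variable [TopologicalSpace S]

theorem IsRegular.exists_path {f : ℚ≥0 → S} (hf : IsRegular f) :
    ∃ g : PathSpace S, restrictRat g = f := by
  -- The path takes at `t` the value of `f` at the rational times immediately after `t`.
  choose F b htb hF using hf.exists_right
  have hright : ∀ t s, t ≤ s → s < b t → F s = F t := by
    intro t s hts hsb
    obtain ⟨d, hd, hd'⟩ := exists_nnrat_between (lt_min (htb s) hsb)
    rw [← hF s d hd (hd'.trans_le (min_le_left _ _)),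
      hF t d (hts.trans_lt hd) (hd'.trans_le (min_le_right _ _))]
  refine ⟨⟨F, fun t => ?_, fun t ht => ?_⟩, ?_⟩
  · refine tendsto_const_nhds.congr' ?_
    filter_upwards [Ico_mem_nhdsGE (htb t)] with s hs
    exact (hright t s hs.1 hs.2).symm
  · obtain ⟨c, a, hat, hc⟩ := hf.exists_left ht
    refine ⟨c, tendsto_const_nhds.congr' ?_⟩
    filter_upwards [Ioo_mem_nhdsLT hat] with s hs
    obtain ⟨d, hd, hd'⟩ := exists_nnrat_between (lt_min (htb s) hs.2)
    rw [← hF s d hd (hd'.trans_le (min_le_left _ _)),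
      hc d (hs.1.trans hd) (hd'.trans_le (min_le_right _ _))]
  · funext d
    obtain ⟨e, hde, he⟩ := hf.2 d
    have hde' : (d : ℝ≥0) < e := by exact_mod_cast hde
    obtain ⟨d', hd, hd'⟩ := exists_nnrat_between (lt_min (htb d) hde')
    change F d = f d
    rw [← hF d d' hd (hd'.trans_le (min_le_left _ _)),
      he d' (by exact_mod_cast hd) (by exact_mod_cast hd'.trans_le (min_le_right _ _))]

variable [DiscreteTopology S]

theorem PathSpace.exists_right (f : PathSpace S) (t : ℝ≥0) :
    ∃ b, t < b ∧ ∀ s, t ≤ s → s < b → f.1 s = f.1 t := by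
  have h : ∀ᶠ s in 𝓝[≥] t, f.1 s = f.1 t := (f.2.1 t).eventually_mem
    ((isOpen_discrete {f.1 t}).mem_nhds rfl)
  obtain ⟨b, hb, hsub⟩ := (mem_nhdsGE_iff_exists_Ico_subset' (lt_add_one t)).1 h
  exact ⟨b, hb, fun s hs hsb => hsub ⟨hs, hsb⟩⟩

theorem PathSpace.exists_left (f : PathSpace S) {t : ℝ≥0} (ht : 0 < t) :
    ∃ c, ∃ a, a < t ∧ ∀ s, a < s → s < t → f.1 s = c := by
  obtain ⟨c, hc⟩ := f.2.2 t ht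
  have h : ∀ᶠ s in 𝓝[<] t, f.1 s = c := hc.eventually_mem ((isOpen_discrete {c}).mem_nhds rfl)
  obtain ⟨a, ha, hsub⟩ := (mem_nhdsLT_iff_exists_Ioo_subset' ht).1 h
  exact ⟨c, a, ha, fun s hs hsb => hsub ⟨hs, hsb⟩⟩

/-- Each time has a neighbourhood with at most one jump, at that time; compactness of `[0, T]` yields
finitely many of them. -/
theorem isRegular_restrictRat (f : PathSpace S) : IsRegular (restrictRat f) := by
  have hloc : ∀ t : ℝ≥0, ∃ p : ℚ × ℚ, ((p.1 : ℝ) < t ∧ t < (p.2 : ℝ)) ∧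
      SingleJumpOn (restrictRat f) p.1 p.2 := by
    intro t
    obtain ⟨b, htb, hb⟩ := f.exists_right t
    obtain ⟨q, htq, hqb⟩ := exists_rat_btwn (NNReal.coe_lt_coe.2 htb)
    obtain ⟨c, a, hat, ha⟩ : ∃ c, ∃ a : ℝ, a < t ∧ ∀ s : ℝ≥0, a < s → s < t → f.1 s = c := by
      rcases eq_zero_or_pos t with rfl | ht
      -- At time `0` there are no earlier times, and any negative left endpoint will do.
      · exact ⟨f.1 0, -1, by simp, fun s _ hs => absurd hs not_lt_zero⟩
      · obtain ⟨c, a, hat, ha⟩ := f.exists_left ht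
        exact ⟨c, a, hat, fun s hs => ha s hs⟩
    obtain ⟨q', haq, hqt⟩ := exists_rat_btwn hat
    refine ⟨(q', q), ⟨hqt, htq⟩, fun d₁ d₂ d₃ h1 h12 h23 h3 => ?_⟩
    have h12' : (d₁ : ℝ≥0) < d₂ := by exact_mod_cast h12
    have h23' : (d₂ : ℝ≥0) < d₃ := by exact_mod_cast h23
    have h3' : (d₃ : ℝ≥0) < b := by
      exact NNReal.coe_lt_coe.1 (h3.trans hqb)
    have h1' : a < ((d₁ : ℝ≥0) : ℝ) := haq.trans h1
    rcases lt_or_ge (d₂ : ℝ≥0) t with h | h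
    · left
      exact (ha d₁ h1' (h12'.trans h)).trans (ha d₂ (h1'.trans h12') h).symm
    · right
      exact (hb d₂ h (h23'.trans h3')).trans (hb d₃ (h.trans h23'.le) h3').symm
  refine ⟨fun T => ?_, fun d => ?_⟩
  · choose p hp hj using hloc
    let U : ℝ≥0 → Set ℝ≥0 := fun t => {s | ((p t).1 : ℝ) < s ∧ (s : ℝ) < (p t).2}
    have hU : ∀ t, U t ∈ 𝓝 t := fun t => IsOpen.mem_nhds
      ((isOpen_lt continuous_const NNReal.continuous_coe).inter
        (isOpen_lt NNReal.continuous_coe continuous_const)) (hp t)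
    obtain ⟨C, -, hC⟩ := (isCompact_Icc (a := (0 : ℝ≥0)) (b := T)).elim_nhds_subcover U
      fun t _ => hU t
    classical
    refine ⟨C.image p, fun t ht => ?_, ?_⟩
    · obtain ⟨s, hs, hts⟩ := mem_iUnion₂.1 (hC ⟨zero_le, ht⟩)
      exact ⟨p s, Finset.mem_image_of_mem p hs, hts⟩
    · intro q hq
      obtain ⟨s, -, rfl⟩ := Finset.mem_image.1 hq
      exact hj s
  · obtain ⟨b, hdb, hb⟩ := f.exists_right d
    obtain ⟨e, hde, heb⟩ := exists_nnrat_between hdb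
    refine ⟨e, by exact_mod_cast hde, fun d' h1 h2 => hb d' ?_ ?_⟩
    · exact_mod_cast h1.le
    · exact lt_trans (by exact_mod_cast h2) heb

theorem pathRel_of_restrictRat {r : S → S → Prop} {f g : PathSpace S}
    (h : ∀ d, r (restrictRat f d) (restrictRat g d)) : PathRel r f g := by
  intro t
  obtain ⟨b, htb, hb⟩ := f.exists_right t
  obtain ⟨b', htb', hb'⟩ := g.exists_right t
  obtain ⟨d, hd, hd'⟩ := exists_nnrat_between (lt_min htb htb')
  rw [← hb d hd.le (hd'.trans_le (min_le_left _ _)),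
    ← hb' d hd.le (hd'.trans_le (min_le_right _ _))]
  exact h d

/-- A path is determined in a measurable way by its values at rational times. -/
theorem measurable_eval_of_rat [Finite S] [MeasurableSpace S] [BorelSpace S] {Ω : Type*}
    [MeasurableSpace Ω] {X : Ω → PathSpace S}
    (hX : ∀ d : ℚ≥0, Measurable fun ω => (X ω).1 d) (t : ℝ≥0) :
    Measurable fun ω => (X ω).1 t := by
  have h : ∀ n : ℕ, ∃ d : ℚ≥0, t < d ∧ (d : ℝ≥0) < t + 1 / ((n : ℝ≥0) + 1) := fun n =>
    exists_nnrat_between (lt_add_of_pos_right t (by positivity))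
  choose d hd hd' using h
  refine measurable_of_tendsto_metrizable (fun n => hX (d n)) (tendsto_pi_nhds.2 fun ω => ?_)
  refine ((X ω).2.1 t).tendsto.comp (tendsto_nhdsWithin_iff.2 ⟨?_, .of_forall fun n => (hd n).le⟩)
  refine tendsto_of_tendsto_of_tendsto_of_le_of_le tendsto_const_nhds ?_ (fun n => (hd n).le)
    (fun n => (hd' n).le)
  simpa using tendsto_const_nhds.add (tendsto_one_div_add_atTop_nhds_zero_nat (𝕜 := ℝ≥0))

/-- Measurable functionals of a path depend, in a measurable way, only on its values at rational
times. -/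
theorem measurable_comap_restrictRat [Finite S] [MeasurableSpace S] [BorelSpace S]
    {φ : PathSpace S → ℝ} (hφ : Measurable φ) :
    Measurable[MeasurableSpace.comap restrictRat MeasurableSpace.pi] φ := by
  refine hφ.mono (Measurable.comap_le (@measurable_pi_lambda _ _ _
    (MeasurableSpace.comap restrictRat MeasurableSpace.pi) _ _ fun t =>
      @measurable_eval_of_rat S _ _ _ _ _ _
        (MeasurableSpace.comap restrictRat MeasurableSpace.pi) (fun f => f) (fun d => ?_) t)) le_rfl
  exact (measurable_pi_apply d).comp (comap_measurable restrictRat)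

end Regularization

/-! ### Coupled generators and the stochastic order on paths -/

section Comparison

variable {S : Type*} [Fintype S] [TopologicalSpace S] [DiscreteTopology S]
  [MeasurableSpace S] [BorelSpace S] {Ω : Type*} [MeasurableSpace Ω] {P : Measure Ω} {r : S → S → Prop} {X Y : Ω → PathSpace S}

/-- An ordered coupling of the values at rational times yields the stochastic order of the paths. -/
theorem stochLE_of_coupling
    (hX : Measurable X) (hY : Measurable Y)
    (h : ∃ π : ProbabilityMeasure (ℚ≥0 → {p : S × S // r p.1 p.2}),
      (π : Measure (ℚ≥0 → {p : S × S // r p.1 p.2})).map (fun z d => (z d).1.1) =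
        P.map (fun ω => restrictRat (X ω)) ∧
      (π : Measure (ℚ≥0 → {p : S × S // r p.1 p.2})).map (fun z d => (z d).1.2) =
        P.map (fun ω => restrictRat (Y ω))) :
    StochLE (PathRel r) P X P Y := by
  obtain ⟨π, h₁, h₂⟩ := h
  rintro φ hφ ⟨C, hC⟩ hmono
  obtain ⟨g, hg, rfl⟩ := (measurable_comap_restrictRat hφ).exists_eq_measurable_comp
  have hp₁ : Measurable fun (z : ℚ≥0 → {p : S × S // r p.1 p.2}) d => (z d).1.1 := by fun_prop
  have hp₂ : Measurable fun (z : ℚ≥0 → {p : S × S // r p.1 p.2}) d => (z d).1.2 := by fun_prop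
  have hlaw : ∀ {p : (ℚ≥0 → {p : S × S // r p.1 p.2}) → ℚ≥0 → S} {U : Ω → PathSpace S},
      Measurable p → Measurable U →
      (π : Measure (ℚ≥0 → {p : S × S // r p.1 p.2})).map p = P.map (fun ω => restrictRat (U ω)) →
      (∀ᵐ z ∂(π : Measure (ℚ≥0 → {p : S × S // r p.1 p.2})), IsRegular (p z)) ∧
      ∫ ω, (g ∘ restrictRat) (U ω) ∂P = ∫ z, g (p z) ∂(π : Measure _) := by
    intro p U hp hU hpU
    have hU' : Measurable fun ω => restrictRat (U ω) := measurable_restrictRat.comp hU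
    constructor
    · refine ae_of_ae_map hp.aemeasurable ?_
      rw [hpU, ae_map_iff hU'.aemeasurable measurableSet_isRegular]
      exact .of_forall fun ω => isRegular_restrictRat (U ω)
    · rw [← integral_map hp.aemeasurable hg.aestronglyMeasurable, hpU,
        integral_map hU'.aemeasurable hg.aestronglyMeasurable]
      rfl
  -- The coupling is carried by restrictions of paths, where `g` is bounded and increasing.
  obtain ⟨hreg₁, hint₁⟩ := hlaw hp₁ hX h₁
  obtain ⟨hreg₂, hint₂⟩ := hlaw hp₂ hY h₂
  have hbd : ∀ f : ℚ≥0 → S, IsRegular f → ‖g f‖ ≤ C := by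
    intro f hf
    obtain ⟨f', rfl⟩ := hf.exists_path
    exact hC f'
  rw [hint₁, hint₂]
  refine integral_mono_ae ?_ ?_ ?_
  · exact .of_bound (hg.comp hp₁).aestronglyMeasurable C (hreg₁.mono fun z hz => hbd _ hz)
  · exact .of_bound (hg.comp hp₂).aestronglyMeasurable C (hreg₂.mono fun z hz => hbd _ hz)
  · filter_upwards [hreg₁, hreg₂] with z hz₁ hz₂
    obtain ⟨f₁, hf₁⟩ := hz₁.exists_path
    obtain ⟨f₂, hf₂⟩ := hz₂.exists_path
    have := hmono f₁ f₂ (pathRel_of_restrictRat fun d => by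
      rw [hf₁, hf₂]
      exact (z d).2)
    simpa [hf₁, hf₂] using this

/-- The jump rates `u` out of `x` and `v` out of `y` can be coupled by jumps from `(x, y)` to
`r`-related pairs: `q` is a row, at `(x, y)`, of a generator on the set of related pairs, and its
two projections are the rows `u` and `v`. The entries on the diagonal, `u x`, `v y` and
`q (x, y)`, are not required to be nonnegative. -/
def CoupledRows (r : S → S → Prop) (x y : S) (u v : S → ℝ) : Prop :=
  ∃ q : S × S → ℝ, (∀ p, ¬ r p.1 p.2 → q p = 0) ∧ (∀ p, p ≠ (x, y) → 0 ≤ q p) ∧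
    (∀ a, ∑ b, q (a, b) = u a) ∧ ∀ b, ∑ a, q (a, b) = v b

/-- If the rows of the two generators can be coupled at each pair of related states, then related
initial states lead to stochastically ordered processes. -/
theorem stochLE_of_coupledRows [DecidableEq S] [IsProbabilityMeasure P] {Q₁ Q₂ : Matrix S S ℝ}
    (hQ : ∀ x y, r x y → CoupledRows r x y (Q₁ x) (Q₂ y))
    (hX : IsMarkovProcess Q₁ P X) (hY : IsMarkovProcess Q₂ P Y)
    (h0 : ∀ᵐ ω ∂P, r ((X ω).1 0) ((Y ω).1 0)) : StochLE (PathRel r) P X P Y := by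
  classical
  choose! q hq hnn hq₁ hq₂ using hQ
  let Q : Matrix {p : S × S // r p.1 p.2} {p : S × S // r p.1 p.2} ℝ :=
    fun z z' => q z.1.1 z.1.2 z'.1
  have hsub : ∀ F : S × S → ℝ, (∀ p, ¬ r p.1 p.2 → F p = 0) →
      ∑ c : {p : S × S // r p.1 p.2}, F c.1 = ∑ p, F p := by
    intro F hF
    rw [← Finset.sum_subtype (Finset.univ.filter fun p : S × S => r p.1 p.2) (by simp) F,
      Finset.sum_filter]
    exact Finset.sum_congr rfl fun p _ => by split_ifs with h; exacts [rfl, (hF p h).symm]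
  have hQ₁ : ProjectsTo (fun z : {p : S × S // r p.1 p.2} => z.1.1) Q Q₁ := by
    intro z a
    refine (hsub (fun p => if p.1 = a then q z.1.1 z.1.2 p else 0)
      fun p hp => by simp [hq _ _ z.2 p hp]).trans ?_
    rw [Fintype.sum_prod_type_right, ← hq₁ _ _ z.2]
    simp
  have hQ₂ : ProjectsTo (fun z : {p : S × S // r p.1 p.2} => z.1.2) Q Q₂ := by
    intro z a
    refine (hsub (fun p => if p.2 = a then q z.1.1 z.1.2 p else 0)
      fun p hp => by simp [hq _ _ z.2 p hp]).trans ?_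
    rw [Fintype.sum_prod_type, ← hq₂ _ _ z.2]
    simp
  have hm : ∀ {U : Ω → PathSpace S}, Measurable U → Measurable fun ω => (U ω).1 0 := fun hU =>
    (measurable_pi_apply 0).comp (measurable_subtype_coe.comp hU)
  have hmX := hm hX.measurable
  have hmY := hm hY.measurable
  have hsum : ∀ (U : Ω → S), Measurable U → (∀ (f : {p : S × S // r p.1 p.2} → S),
      (∀ᵐ ω ∂P, ∀ h : r ((X ω).1 0) ((Y ω).1 0), f ⟨((X ω).1 0, (Y ω).1 0), h⟩ = U ω) →
      ∀ a, ∑ z : {p : S × S // r p.1 p.2}, (if f z = a then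
        P.real {ω | (X ω).1 0 = z.1.1 ∧ (Y ω).1 0 = z.1.2} else 0) = P.real {ω | U ω = a}) := by
    intro U hU f hf a
    rw [← Finset.sum_filter, ← measureReal_biUnion_finset]
    · refine measureReal_congr (eventuallyEq_set.2 ?_)
      filter_upwards [h0, hf] with ω hω hfω
      simp only [Finset.mem_filter, Finset.mem_univ, true_and, mem_iUnion, exists_prop,
        mem_ofPred_eq]
      constructor
      · rintro ⟨z, rfl, hz₁, hz₂⟩
        rw [← hfω hω]
        exact congrArg f (Subtype.ext (Prod.ext hz₁ hz₂))
      · rintro rfl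
        exact ⟨⟨_, hω⟩, hfω hω, rfl, rfl⟩
    · intro z _ z' _ hne
      refine Set.disjoint_left.2 fun ω h h' => hne ?_
      exact Subtype.ext (Prod.ext (h.1.symm.trans h'.1) (h.2.symm.trans h'.2))
    · exact fun z _ => ((hmX (measurableSet_singleton z.1.1)).inter
        (hmY (measurableSet_singleton z.1.2)))
  have hex := exists_coupling_finset (Z := {p : S × S // r p.1 p.2}) (p₁ := fun z => z.1.1)
    (p₂ := fun z => z.1.2)
    (fun z z' hne => hnn _ _ z.2 _ fun h => hne (Subtype.ext h.symm)) hQ₁ hQ₂ hX hY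
    ⟨fun z => P.real {ω | (X ω).1 0 = z.1.1 ∧ (Y ω).1 0 = z.1.2}, fun z => measureReal_nonneg,
      hsum _ hmX _ (.of_forall fun _ _ => rfl), hsum _ hmY _ (.of_forall fun _ _ => rfl)⟩
  have : IsProbabilityMeasure (P.map fun ω => restrictRat (X ω)) :=
    Measure.isProbabilityMeasure_map (measurable_restrictRat.comp hX.measurable).aemeasurable
  have : IsProbabilityMeasure (P.map fun ω => restrictRat (Y ω)) :=
    Measure.isProbabilityMeasure_map (measurable_restrictRat.comp hY.measurable).aemeasurable
  exact stochLE_of_coupling hX.measurable hY.measurable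
    (exists_coupling_of_finite _ _ (fun z : {p : S × S // r p.1 p.2} => z.1.1) (fun z => z.1.2)
      fun F => ⟨insert 0 F, Finset.subset_insert _ _, hex _ (Finset.mem_insert_self _ _)⟩)

end Comparison

/-! ### Couplings of the rates out of a pair of states -/

section CoupledRows

/-- The row at `x` of a generator with a single jump, from `x` to `x'` at rate one. -/
def jumpRow {S : Type*} [DecidableEq S] (x x' : S) : S → ℝ := Pi.single x' 1 - Pi.single x 1

@[simp]
theorem jumpRow_self {S : Type*} [DecidableEq S] (x : S) : jumpRow x x = 0 := sub_self _

variable {S : Type*} [Fintype S] {r : S → S → Prop} {x y : S}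

theorem CoupledRows.zero : CoupledRows r x y 0 0 :=
  ⟨0, fun _ _ => rfl, fun _ _ => le_rfl, fun _ => by simp, fun _ => by simp⟩

theorem CoupledRows.add {u v u' v' : S → ℝ} (h : CoupledRows r x y u v)
    (h' : CoupledRows r x y u' v') : CoupledRows r x y (u + u') (v + v') := by
  obtain ⟨q, h₁, h₂, h₃, h₄⟩ := h
  obtain ⟨q', h₁', h₂', h₃', h₄'⟩ := h'
  refine ⟨q + q', fun p hp => ?_, fun p hp => add_nonneg (h₂ p hp) (h₂' p hp), fun a => ?_,
    fun b => ?_⟩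
  · simp [h₁ p hp, h₁' p hp]
  · simp [Finset.sum_add_distrib, h₃, h₃']
  · simp [Finset.sum_add_distrib, h₄, h₄']

theorem CoupledRows.sum {ι : Type*} (s : Finset ι) {u v : ι → S → ℝ}
    (h : ∀ i ∈ s, CoupledRows r x y (u i) (v i)) :
    CoupledRows r x y (∑ i ∈ s, u i) (∑ i ∈ s, v i) := by
  classical
  induction s using Finset.induction_on with
  | empty => simpa using CoupledRows.zero
  | insert i s hi ih =>
    rw [Finset.sum_insert hi, Finset.sum_insert hi]
    exact (h i (Finset.mem_insert_self _ _)).add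
      (ih fun j hj => h j (Finset.mem_insert_of_mem hj))

variable [DecidableEq S]

theorem sum_jumpRow (x x' : S) : ∑ a, jumpRow x x' a = 0 := by
  simp [jumpRow]

theorem CoupledRows.jump (hxy : r x y) {x' y' : S} {c : ℝ} (hc : 0 ≤ c) (h : 0 < c → r x' y') :
    CoupledRows r x y (c • jumpRow x x') (c • jumpRow y y') := by
  rcases hc.eq_or_lt with rfl | hc'
  · simpa using CoupledRows.zero
  refine ⟨c • jumpRow (x, y) (x', y'), fun p hp => ?_, fun p hp => ?_, fun a => ?_, fun b => ?_⟩
  · have h₁ : p ≠ (x', y') := by rintro rfl; exact hp (h hc')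
    have h₂ : p ≠ (x, y) := by rintro rfl; exact hp hxy
    simp [jumpRow, h₁, h₂]
  · have : 0 ≤ (Pi.single (x', y') 1 : S × S → ℝ) p :=
      (Pi.single_nonneg.2 zero_le_one : (0 : S × S → ℝ) ≤ Pi.single (x', y') 1) p
    simpa [jumpRow, hp] using mul_nonneg hc this
  · simp [jumpRow, Pi.single_apply, Prod.ext_iff, ← Finset.mul_sum, ite_and, Finset.sum_ite_irrel]
  · simp [jumpRow, Pi.single_apply, Prod.ext_iff, ← Finset.mul_sum, ite_and]

theorem CoupledRows.jump_left (hxy : r x y) {x' : S} {c : ℝ} (hc : 0 ≤ c) (h : 0 < c → r x' y) :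
    CoupledRows r x y (c • jumpRow x x') 0 := by
  simpa using CoupledRows.jump (y' := y) hxy hc h

theorem CoupledRows.jump_right (hxy : r x y) {y' : S} {c : ℝ} (hc : 0 ≤ c) (h : 0 < c → r x y') :
    CoupledRows r x y 0 (c • jumpRow y y') := by
  simpa using CoupledRows.jump (x' := x) hxy hc h

/-- If the total rate of the jumps of the second component is at most that of the first one, then
each jump of the second component can be made simultaneous with a jump of the first one, by
distributing its rate over these proportionally to `α`. -/
theorem CoupledRows.sum_jump {ι κ : Type*} [Fintype ι] [Fintype κ] (hxy : r x y) {α : ι → ℝ}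
    {β : κ → ℝ} (hα : ∀ i, 0 ≤ α i) (hβ : ∀ j, 0 ≤ β j) (hle : ∑ j, β j ≤ ∑ i, α i)
    {f : ι → S} {g : κ → S} (hf : ∀ i, 0 < α i → r (f i) y)
    (hfg : ∀ i j, 0 < α i → 0 < β j → r (f i) (g j)) :
    CoupledRows r x y (∑ i, α i • jumpRow x (f i)) (∑ j, β j • jumpRow y (g j)) := by
  set A := ∑ i, α i with hA
  set B := ∑ j, β j with hB
  have hB0 : 0 ≤ B := Finset.sum_nonneg fun j _ => hβ j
  rcases (hB0.trans hle).eq_or_lt with hA0 | hA0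
  · have hα0 : ∀ i, α i = 0 := fun i =>
      (Finset.sum_eq_zero_iff_of_nonneg fun i _ => hα i).1 hA0.symm i (Finset.mem_univ i)
    have hβ0 : ∀ j, β j = 0 := fun j => (Finset.sum_eq_zero_iff_of_nonneg fun j _ => hβ j).1
      (le_antisymm (hle.trans hA0.ge) hB0) j (Finset.mem_univ j)
    simpa [hα0, hβ0] using CoupledRows.zero
  -- The jumps to `f i` and `g j` occur together at rate `α i * β j / A`, and the remaining rate
  -- `α i * (1 - B / A)` is left to jumps of the first component alone.
  have h₁ : CoupledRows r x y (∑ i, ∑ j, (α i * β j / A) • jumpRow x (f i))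
      (∑ i, ∑ j, (α i * β j / A) • jumpRow y (g j)) := by
    refine .sum _ fun i _ => .sum _ fun j _ =>
      .jump hxy (div_nonneg (mul_nonneg (hα i) (hβ j)) hA0.le) fun hpos => ?_
    have hne : α i * β j ≠ 0 := fun h => by simp [h] at hpos
    exact hfg i j ((hα i).lt_of_ne' (left_ne_zero_of_mul hne))
      ((hβ j).lt_of_ne' (right_ne_zero_of_mul hne))
  have h₂ : CoupledRows r x y (∑ i, (α i * (1 - B / A)) • jumpRow x (f i)) (∑ _i : ι, 0) := by
    have hBA : 0 ≤ 1 - B / A := sub_nonneg.2 ((div_le_one hA0).2 hle)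
    refine .sum _ fun i _ => .jump_left hxy (mul_nonneg (hα i) hBA) fun hpos => ?_
    exact hf i ((hα i).lt_of_ne' fun h => by simp [h] at hpos)
  convert h₁.add h₂ using 1
  · rw [← Finset.sum_add_distrib]
    refine Finset.sum_congr rfl fun i _ => ?_
    rw [← Finset.sum_smul, ← add_smul, ← Finset.sum_div, ← Finset.mul_sum, ← hB]
    congr 1
    field_simp
    ring
  · rw [Finset.sum_comm, Finset.sum_const_zero, add_zero]
    refine Finset.sum_congr rfl fun j _ => ?_
    rw [← Finset.sum_smul, ← Finset.sum_div, ← Finset.sum_mul, ← hA]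
    congr 1
    field_simp

end CoupledRows

/-! ### Arrivals and departures preserve the order -/

section States

variable {K : ℕ} {m : Fin K → ℕ} {n : ℕ}

theorem total_eq (x : Fin 2 → Fin K → ℕ) : total x = ∑ k, x 0 k + ∑ k, x 1 k := by
  simp [total, Fin.sum_univ_two]

theorem unitVec_apply (i : Fin 2) (k : Fin K) (j : Fin 2) (l : Fin K) :
    unitVec i k j l = if j = i ∧ l = k then 1 else 0 := by
  by_cases hj : j = i
  · subst hj; simp [unitVec, Pi.single_apply]
  · simp [unitVec, hj]

theorem sum_unitVec (i : Fin 2) (k : Fin K) (j : Fin 2) :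
    ∑ l, unitVec i k j l = if j = i then 1 else 0 := by
  simp [unitVec_apply, ite_and]

theorem total_add_unitVec (x : Fin 2 → Fin K → ℕ) (i : Fin 2) (k : Fin K) :
    total (x + unitVec i k) = total x + 1 := by
  simp only [total, Pi.add_apply, Finset.sum_add_distrib, sum_unitVec]
  simp

theorem unitVec_le {x : Fin 2 → Fin K → ℕ} {i : Fin 2} {k : Fin K} (h : 0 < x i k) :
    unitVec i k ≤ x := by
  intro j l
  rw [unitVec_apply]
  split_ifs with hjl
  · rw [hjl.1, hjl.2]; exact h
  · exact Nat.zero_le _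

/-- The state after the departure of a class-`k` customer from layer `i`; if there is no such
customer, the state does not change. -/
def departState (x : State m n) (i : Fin 2) (k : Fin K) : State m n :=
  ⟨x.1 - unitVec i k, fun l => (Nat.sub_le _ _).trans (x.2.1 l),
    (Finset.sum_le_sum fun _ _ => Nat.sub_le _ _).trans x.2.2⟩

theorem departState_apply (x : State m n) (i : Fin 2) (k : Fin K) (j : Fin 2) (l : Fin K) :
    (departState x i k).1 j l = x.1 j l - if j = i ∧ l = k then 1 else 0 := by
  rw [← unitVec_apply]; rfl

theorem departState_add {x : State m n} {i : Fin 2} {k : Fin K} (h : 0 < x.1 i k) :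
    (departState x i k).1 + unitVec i k = x.1 :=
  tsub_add_cancel_of_le (unitVec_le h)

theorem total_departState {x : State m n} {i : Fin 2} {k : Fin K} (h : 0 < x.1 i k) :
    total (departState x i k).1 + 1 = total x.1 := by
  rw [← total_add_unitVec _ i k, departState_add h]

theorem total_departState_le (x : State m n) (i : Fin 2) (k : Fin K) :
    total (departState x i k).1 ≤ total x.1 :=
  Finset.sum_le_sum fun _ _ => Finset.sum_le_sum fun _ _ => Nat.sub_le _ _

/-- The state after the arrival of a class-`k` customer, who is assigned to layer 1 if possible,
otherwise to layer 2 if possible, and is lost otherwise. -/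
def arriveState (x : State m n) (k : Fin K) : State m n :=
  if h : x.1 0 k < m k then ⟨x.1 + unitVec 0 k, fun l => by
      have := x.2.1 l
      by_cases hl : l = k
      · subst hl; simp [unitVec_apply]; omega
      · simpa [unitVec_apply, hl] using this,
    by simpa [Finset.sum_add_distrib, sum_unitVec] using x.2.2⟩
  else if h : ∑ l, x.1 1 l < n then ⟨x.1 + unitVec 1 k, fun l => by
      simpa [unitVec_apply] using x.2.1 l,
    by simpa [Finset.sum_add_distrib, sum_unitVec] using h⟩
  else x

theorem arriveState_of_lt {x : State m n} {k : Fin K} (h : x.1 0 k < m k) :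
    (arriveState x k).1 = x.1 + unitVec 0 k := by
  simp [arriveState, h]

theorem arriveState_of_overflow {x : State m n} {k : Fin K} (h : ¬ x.1 0 k < m k)
    (h' : ∑ l, x.1 1 l < n) : (arriveState x k).1 = x.1 + unitVec 1 k := by
  simp [arriveState, h, h']

theorem arriveState_of_lost {x : State m n} {k : Fin K} (h : ¬ x.1 0 k < m k)
    (h' : ¬ ∑ l, x.1 1 l < n) : arriveState x k = x := by
  simp [arriveState, h, h']

variable {x y : State m n}

theorem Preceq.refl (x : State m n) : Preceq x x := ⟨fun _ => le_rfl, le_rfl⟩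

theorem Preceq.trans {z : State m n} (h : Preceq x y) (h' : Preceq y z) : Preceq x z :=
  ⟨fun k => (h.1 k).trans (h'.1 k), h.2.trans h'.2⟩

theorem preceq_arriveState (x : State m n) (k : Fin K) : Preceq x (arriveState x k) := by
  have hle : x.1 ≤ (arriveState x k).1 := by
    by_cases h : x.1 0 k < m k
    · rw [arriveState_of_lt h]; exact le_self_add
    by_cases h' : ∑ l, x.1 1 l < n
    · rw [arriveState_of_overflow h h']; exact le_self_add
    · rw [arriveState_of_lost h h']
  exact ⟨hle 0, Finset.sum_le_sum fun _ _ => Finset.sum_le_sum fun _ _ => hle _ _⟩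

/-- If `y` loses the arriving customer but `x` does not, then `|x| < |y|`: in that case layer 2 is
full in `y`, and `x` has a free server that is busy in `y`. -/
theorem Preceq.arriveState (h : Preceq x y) (k : Fin K) :
    Preceq (arriveState x k) (arriveState y k) := by
  have hx := x.2.2
  have htx := total_eq x.1
  have hty := total_eq y.1
  have hk := h.1 k
  have hyk := y.2.1 k
  have hle : ∑ k, x.1 0 k ≤ ∑ k, y.1 0 k := Finset.sum_le_sum fun k _ => h.1 k
  by_cases hx₁ : x.1 0 k < m k
  · have hx₁' := arriveState_of_lt hx₁
    by_cases hy₁ : y.1 0 k < m k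
    · have hy₁' := arriveState_of_lt hy₁
      refine ⟨fun l => ?_, ?_⟩
      · rw [hx₁', hy₁']
        exact Nat.add_le_add_right (h.1 l) _
      · rw [hx₁', hy₁', total_add_unitVec, total_add_unitVec]
        exact Nat.succ_le_succ h.2
    · have hcoord : ∀ l, (TwoLayerLoss.arriveState x k).1 0 l ≤ y.1 0 l := by
        intro l
        rw [hx₁', Pi.add_apply, Pi.add_apply, unitVec_apply]
        by_cases hl : l = k
        · subst hl; simp; omega
        · simpa [hl] using h.1 l
      refine ⟨fun l => (hcoord l).trans ((preceq_arriveState y k).1 l), ?_⟩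
      rw [hx₁', total_add_unitVec]
      by_cases hy₂ : ∑ l, y.1 1 l < n
      · rw [arriveState_of_overflow hy₁ hy₂, total_add_unitVec]
        exact Nat.succ_le_succ h.2
      · rw [arriveState_of_lost hy₁ hy₂]
        -- Layer 2 is full in `y`, so the strict inequality at layer 1 gives `|x| < |y|`.
        have hlt : ∑ k, x.1 0 k < ∑ k, y.1 0 k :=
          Finset.sum_lt_sum (fun k _ => h.1 k) ⟨k, Finset.mem_univ k, by omega⟩
        omega
  by_cases hx₂ : ∑ l, x.1 1 l < n
  · have hx₂' := arriveState_of_overflow hx₁ hx₂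
    have hy₁ : ¬ y.1 0 k < m k := by omega
    refine ⟨fun l => ?_, ?_⟩
    · refine le_trans ?_ ((preceq_arriveState y k).1 l)
      rw [hx₂', Pi.add_apply, Pi.add_apply, unitVec_apply]
      simpa using h.1 l
    · rw [hx₂', total_add_unitVec]
      by_cases hy₂ : ∑ l, y.1 1 l < n
      · rw [arriveState_of_overflow hy₁ hy₂, total_add_unitVec]
        exact Nat.succ_le_succ h.2
      · rw [arriveState_of_lost hy₁ hy₂]
        omega
  · rw [arriveState_of_lost hx₁ hx₂]
    exact h.trans (preceq_arriveState y k)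

theorem departState_preceq (x : State m n) (i : Fin 2) (k : Fin K) :
    Preceq (departState x i k) x :=
  ⟨fun _ => Nat.sub_le _ _, total_departState_le x i k⟩

/-- Simultaneous departures from layer 1. -/
theorem Preceq.departState_zero (h : Preceq x y) {k : Fin K} (hk : 0 < x.1 0 k) :
    Preceq (departState x 0 k) (departState y 0 k) := by
  refine ⟨fun l => ?_, ?_⟩
  · rw [departState_apply, departState_apply]
    exact Nat.sub_le_sub_right (h.1 l) _
  · have h₁ := total_departState hk
    have h₂ := total_departState (hk.trans_le (h.1 k))
    have := h.2
    omega

/-- In `y`, the number of class-`k` customers at layer `i` who are not paired with a class-`k`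
customer at layer 1 of `x`. -/
def unpaired (x y : State m n) (i : Fin 2) (k : Fin K) : ℕ :=
  if i = 0 then y.1 0 k - x.1 0 k else y.1 1 k

/-- An unpaired customer may depart from `y` if `x` moves to a state `x'` with fewer customers
than `y`. -/
theorem Preceq.departState_unpaired {x' : State m n} (h : Preceq x y) (hx' : Preceq x' x)
    (hlt : total x'.1 < total y.1) {i : Fin 2} {k : Fin K} (hi : 0 < unpaired x y i k) :
    Preceq x' (departState y i k) := by
  have hpos : 0 < y.1 i k := by
    unfold unpaired at hi
    fin_cases i
    · simp at hi ⊢; omega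
    · simpa using hi
  refine ⟨fun l => ?_, ?_⟩
  · refine (hx'.1 l).trans ?_
    rw [departState_apply]
    have := h.1 l
    split_ifs with hl
    · obtain ⟨rfl, rfl⟩ := hl
      simp [unpaired] at hi
      omega
    · simpa using this
  · have := total_departState hpos
    omega

theorem sum_unpaired (h : Preceq x y) :
    ∑ i, ∑ k, unpaired x y i k + ∑ k, x.1 0 k = total y.1 := by
  rw [Fin.sum_univ_two, total_eq]
  simp only [unpaired, if_true, one_ne_zero, if_false]
  have : ∑ k, (y.1 0 k - x.1 0 k) + ∑ k, x.1 0 k = ∑ k, y.1 0 k := by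
    rw [← Finset.sum_add_distrib]
    exact Finset.sum_congr rfl fun k _ => Nat.sub_add_cancel (h.1 k)
  omega

end States

/-! ### The coupled loss systems -/

section Generator

variable {K : ℕ} {m : Fin K → ℕ} {n : ℕ}

theorem jumpRow_of_ne {S : Type*} [DecidableEq S] {x x' a : S} (h : a ≠ x) :
    jumpRow x x' a = if x' = a then 1 else 0 := by
  simp [jumpRow, Pi.single_apply, h, eq_comm]

/-- If there is no class-`k` customer at layer `i`, both sides vanish. -/
theorem ite_departureRate (mu : Fin K → ℝ) {x a : State m n} (i : Fin 2) (k : Fin K)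
    (ha : a ≠ x) :
    (if x.1 = a.1 + unitVec i k then departureRate m n mu i k x else 0) =
      mu k * x.1 i k * jumpRow x (departState x i k) a := by
  rw [jumpRow_of_ne ha, departureRate, mul_ite, mul_one, mul_zero]
  rcases Nat.eq_zero_or_pos (x.1 i k) with h0 | hpos
  · simp [h0]
  · refine if_congr ?_ rfl rfl
    rw [← Subtype.val_inj, ← departState_add hpos, add_left_inj]

theorem sum_ite_arrivalRate (lam : Fin K → ℝ) {x a : State m n} (k : Fin K) (ha : a ≠ x) :
    ∑ i, (if a.1 = x.1 + unitVec i k then arrivalRate m n lam i k x else 0) =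
      lam k * jumpRow x (arriveState x k) a := by
  classical
  have h₀ : arrivalRate m n lam 0 k x = if x.1 0 k < m k then lam k else 0 := by
    simp [arrivalRate, acceptSet, indicator_apply]
  have h₁ : arrivalRate m n lam 1 k x =
      if x.1 0 k = m k ∧ ∑ l, x.1 1 l < n then lam k else 0 := by
    simp [arrivalRate, acceptSet, indicator_apply]
  have hle := x.2.1 k
  rw [jumpRow_of_ne ha, Fin.sum_univ_two, h₀, h₁, mul_ite, mul_one, mul_zero]
  simp only [← Subtype.val_inj (a := arriveState x k)]
  by_cases hx₁ : x.1 0 k < m k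
  · simp [hx₁, hx₁.ne, arriveState_of_lt hx₁, eq_comm]
  have heq : x.1 0 k = m k := by omega
  by_cases hx₂ : ∑ l, x.1 1 l < n
  · simp [heq, hx₂, arriveState_of_overflow hx₁ hx₂, eq_comm]
  · have hne : ¬ x.1 = a.1 := fun h => ha (Subtype.ext h.symm)
    simp [hx₁, hx₂, arriveState_of_lost hx₁ hx₂, hne]

/-- The generator as a sum over arrivals and departures of single customers. It is enough to compare
the entries off the diagonal, as both sides have zero sum. -/
theorem generator_row (lam mu : Fin K → ℝ) (x : State m n) :
    generator (arrivalRate m n lam) (departureRate m n mu) x =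
      ∑ k, lam k • jumpRow x (arriveState x k) +
        ∑ i, ∑ k, (mu k * x.1 i k) • jumpRow x (departState x i k) := by
  set R := ∑ k, lam k • jumpRow x (arriveState x k) +
        ∑ i, ∑ k, (mu k * x.1 i k) • jumpRow x (departState x i k) with hR
  have hsum : ∑ a, R a = 0 := by
    simp only [hR, Pi.add_apply, Finset.sum_apply, Pi.smul_apply, smul_eq_mul,
      Finset.sum_add_distrib]
    rw [Finset.sum_comm, Finset.sum_comm (s := Finset.univ (α := State m n))]
    simp only [← Finset.mul_sum, sum_jumpRow, mul_zero, Finset.sum_const_zero, zero_add]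
    refine Finset.sum_eq_zero fun i _ => ?_
    rw [Finset.sum_comm]
    simp only [← Finset.mul_sum, sum_jumpRow, mul_zero, Finset.sum_const_zero]
  have hoff : ∀ a, a ≠ x → jumpRate (arrivalRate m n lam) (departureRate m n mu) x a = R a := by
    intro a ha
    simp only [jumpRate, Finset.sum_add_distrib, ite_departureRate mu _ _ ha]
    rw [Finset.sum_comm]
    simp only [sum_ite_arrivalRate lam _ ha]
    simp [hR, Finset.sum_apply]
  funext a
  rw [generator]
  split_ifs with h
  · subst h
    rw [Finset.sum_congr rfl fun z hz => hoff z (Finset.ne_of_mem_erase hz),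
      ← Finset.add_sum_erase _ _ (Finset.mem_univ x)] at *
    linarith
  · exact hoff a (Ne.symm h)

variable {lam mu mu' : Fin K → ℝ}

/-- If the service rates `mu'` dominate a constant `c` which dominates `mu`, then the rates of the two
loss systems can be coupled at each ordered pair of states. -/
theorem coupledRows_generator (hlam : ∀ k, 0 ≤ lam k) (hmu : ∀ k, 0 ≤ mu k) {c : ℝ}
    (hc : ∀ k, mu k ≤ c) (hc' : ∀ k, c ≤ mu' k) {x y : State m n} (h : Preceq x y) :
    CoupledRows Preceq x y (generator (arrivalRate m n lam) (departureRate m n mu') x)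
      (generator (arrivalRate m n lam) (departureRate m n mu) y) := by
  have hmu' : ∀ k, mu k ≤ mu' k := fun k => (hc k).trans (hc' k)
  set α : Fin K → ℝ := fun k => mu' k * x.1 1 k with hα
  set β : Fin 2 × Fin K → ℝ := fun p => mu p.2 * unpaired x y p.1 p.2 with hβ
  have hα0 : ∀ k, 0 ≤ α k := fun k =>
    mul_nonneg ((hmu k).trans (hmu' k)) (Nat.cast_nonneg _)
  have hβ0 : ∀ p, 0 ≤ β p := fun p => mul_nonneg (hmu _) (Nat.cast_nonneg _)
  have hαpos : ∀ k, 0 < α k → 0 < x.1 1 k := fun k hk => by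
    refine Nat.pos_of_ne_zero fun h0 => ?_
    simp [hα, h0] at hk
  have hβpos : ∀ p, 0 < β p → 0 < unpaired x y p.1 p.2 := fun p hp => by
    refine Nat.pos_of_ne_zero fun h0 => ?_
    simp [hβ, h0] at hp
  have harr : CoupledRows Preceq x y (∑ k, lam k • jumpRow x (arriveState x k))
      (∑ k, lam k • jumpRow y (arriveState y k)) :=
    .sum _ fun k _ => .jump h (hlam k) fun _ => h.arriveState k
  -- Of the layer-1 departures from `x`, the part at rate `mu k * x 0 k` coincides with departures
  -- from `y`, and the part `hleft` occurs alone.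
  have hpair : CoupledRows Preceq x y (∑ k, (mu k * x.1 0 k) • jumpRow x (departState x 0 k))
      (∑ k, (mu k * x.1 0 k) • jumpRow y (departState y 0 k)) := by
    refine .sum _ fun k _ => .jump h (mul_nonneg (hmu k) (Nat.cast_nonneg _)) fun hpos => ?_
    refine h.departState_zero (Nat.pos_of_ne_zero fun h0 => ?_)
    simp [h0] at hpos
  have hleft : CoupledRows Preceq x y
      (∑ k, ((mu' k - mu k) * x.1 0 k) • jumpRow x (departState x 0 k)) (∑ _k : Fin K, 0) :=
    .sum _ fun k _ => .jump_left h
      (mul_nonneg (sub_nonneg.2 (hmu' k)) (Nat.cast_nonneg _))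
      fun _ => (departState_preceq x 0 k).trans h
  -- The layer-2 departures from `x` against the departures of unpaired customers from `y`.
  have hrest : CoupledRows Preceq x y (∑ k, α k • jumpRow x (departState x 1 k))
      (∑ p, β p • jumpRow y (departState y p.1 p.2)) := by
    rcases h.2.lt_or_eq with hlt | heq
    · have h₁ : CoupledRows Preceq x y (∑ k, α k • jumpRow x (departState x 1 k))
          (∑ _k : Fin K, 0) :=
        .sum _ fun k _ => .jump_left h (hα0 k) fun _ => (departState_preceq x 1 k).trans h
      have h₂ : CoupledRows Preceq x y (∑ _p : Fin 2 × Fin K, 0)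
          (∑ p, β p • jumpRow y (departState y p.1 p.2)) :=
        .sum _ fun p _ => .jump_right h (hβ0 p) fun hp =>
          h.departState_unpaired (Preceq.refl x) hlt (hβpos p hp)
      simpa using h₁.add h₂
    · refine .sum_jump h hα0 hβ0 ?_ (fun k _ => (departState_preceq x 1 k).trans h)
        fun k p hk hp => ?_
      · have hcount : ∑ p : Fin 2 × Fin K, unpaired x y p.1 p.2 = ∑ k, x.1 1 k := by
          have h₁ := sum_unpaired h
          have h₂ := total_eq x.1
          have h₃ := h.2
          rw [Fintype.sum_prod_type]
          dsimp only
          omega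
        calc ∑ p, β p ≤ ∑ p : Fin 2 × Fin K, c * unpaired x y p.1 p.2 :=
              Finset.sum_le_sum fun p _ => mul_le_mul_of_nonneg_right (hc _) (Nat.cast_nonneg _)
          _ = ∑ k, c * x.1 1 k := by
              rw [← Finset.mul_sum, ← Finset.mul_sum]
              exact_mod_cast congrArg (fun N : ℕ => c * (N : ℝ)) hcount
          _ ≤ ∑ k, α k :=
              Finset.sum_le_sum fun k _ => mul_le_mul_of_nonneg_right (hc' _) (Nat.cast_nonneg _)
      · have := total_departState (hαpos k hk)
        exact h.departState_unpaired (departState_preceq x 1 k) (by omega) (hβpos p hp)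
  have hx : ∑ k, (mu' k * x.1 0 k) • jumpRow x (departState x 0 k) =
      ∑ k, (mu k * x.1 0 k) • jumpRow x (departState x 0 k) +
        ∑ k, ((mu' k - mu k) * x.1 0 k) • jumpRow x (departState x 0 k) := by
    rw [← Finset.sum_add_distrib]
    simp only [← add_smul, ← add_mul, add_sub_cancel]
  have hy : ∑ k, (mu k * y.1 0 k) • jumpRow y (departState y 0 k) =
      ∑ k, (mu k * x.1 0 k) • jumpRow y (departState y 0 k) +
        ∑ k, β (0, k) • jumpRow y (departState y 0 k) := by
    rw [← Finset.sum_add_distrib]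
    refine Finset.sum_congr rfl fun k _ => ?_
    rw [← add_smul, ← mul_add]
    simp [unpaired, Nat.cast_sub (h.1 k)]
  rw [generator_row, generator_row]
  convert harr.add ((hpair.add hleft).add hrest) using 1
  · rw [Fin.sum_univ_two, hx]
  · rw [Fin.sum_univ_two, hy, Fintype.sum_prod_type, Fin.sum_univ_two, Finset.sum_const_zero,
      add_zero, add_assoc (∑ k, (mu k * (x.1 0 k : ℝ)) • jumpRow y (departState y 0 k))]
    rfl

end Generator

end TwoLayerLoss
end

theorem theorem4 {K : ℕ} [NeZero K] (m : Fin K → ℕ) (n : ℕ) (lam mu : Fin K → ℝ)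
    (hlam : ∀ k, 0 ≤ lam k) (hmu : ∀ k, 0 ≤ mu k)
    {Ω : Type*} [MeasurableSpace Ω] (P : Measure Ω) [IsProbabilityMeasure P]
    (Xminus X Xplus : Ω → TwoLayerLoss.PathSpace (TwoLayerLoss.State m n))
    (hX : TwoLayerLoss.IsLossSystem m n lam mu P X)
    (hXminus : TwoLayerLoss.IsLossSystem m n lam
      (fun _ => Finset.univ.sup' Finset.univ_nonempty mu) P Xminus)
    (hXplus : TwoLayerLoss.IsLossSystem m n lam
      (fun _ => Finset.univ.inf' Finset.univ_nonempty mu) P Xplus)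
    (hinit_minus : ∀ᵐ ω ∂P, TwoLayerLoss.Preceq ((Xminus ω).1 0) ((X ω).1 0))
    (hinit_plus : ∀ᵐ ω ∂P, TwoLayerLoss.Preceq ((X ω).1 0) ((Xplus ω).1 0)) :
    TwoLayerLoss.StochLE (TwoLayerLoss.PathRel TwoLayerLoss.Preceq) P Xminus P X ∧
      TwoLayerLoss.StochLE (TwoLayerLoss.PathRel TwoLayerLoss.Preceq) P X P Xplus := by
  constructor
  · exact TwoLayerLoss.stochLE_of_coupledRows
      (fun x y h => TwoLayerLoss.coupledRows_generator hlam hmu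
        (fun k => Finset.le_sup' mu (Finset.mem_univ k)) (fun _ => le_rfl) h)
      hXminus hX hinit_minus
  · exact TwoLayerLoss.stochLE_of_coupledRows
      (fun x y h => TwoLayerLoss.coupledRows_generator hlam
        (fun _ => Finset.le_inf' _ _ fun k _ => hmu k) (fun _ => le_rfl)
        (fun k => Finset.inf'_le mu (Finset.mem_univ k)) h)
      hX hXplus hinit_plus
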